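/- Let $\mathcal C$ be a finite set (the codebook), let $P(\cdot\mid\cdot)$ be a transition kernel on $\mathcal C$ with stationary distribution $\pi$, and let $\delta>0$ satisfy $P(a'\mid a)\ge\delta$ for all $a,a'\in\mathcal C$ (for instance $\delta=\min_{a,a'}P(a'\mid a)$, if this is positive); in particular the chain is ergodic. For every $m\in\mathbb N$ let $\boldsymbol X=(X_{ij})_{1\le i,j\le m}$ be a random $m\times m$ image with patches in $\mathcal C$, generated in one of two ways. Column-wise: the columns are independent, and each, read from top to bottom, is a Markov chain with kernel $P$ started from $\pi$. Row-wise: the rows are independent, and each, read from left to right, is a Markov chain with kernel $P$ started from $\pi$. Put $$H_\infty=-\sum_{a\in\mathcal C}\sum_{a'\in\mathcal C}\pi(a)P(a'\mid a)\log P(a'\mid a).$$ A tokenizer consists of a finite dictionary $\mathrm{Dict}$ of nonempty strings over $\mathcal C$ (tokens) and an encoding function mapping every finite string over $\mathcal C$ to a finite sequence of tokens whose concatenation is that string. It encodes an image by the function $\operatorname{enc}$ that concatenates the encodings of the successive columns (in the column-wise case) or of the successive rows (in the row-wise case). A unigram model $Q\in\mathcal Q_{\text{1-gram}}$ on $\mathrm{Dict}$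 is given by a probability distribution $Q_\#$ on $\mathbb N=\{0,1,2,\dots\}$ and a probability distribution $Q_{\mathrm{tok}}$ on $\mathrm{Dict}$, through $Q(t_1,\dots,t_n)=Q_\#(n)\prod_{r=1}^n Q_{\mathrm{tok}}(t_r)$. Its loss is $\mathcal L_m(Q\circ\operatorname{enc})=-\frac1{m^2}\mathbb E[\log Q(\operatorname{enc}(\boldsymbol X))]\in[0,\infty]$, with $-\log 0=\infty$. Then there is a $D_0$, depending only on $\delta$, such that for every integer $D\ge D_0$ there is a tokenizer with $|\mathrm{Dict}|\le D$ for which $\operatorname{enc}$ is injective on $m\times m$ images for every $m$, and $$\limsup_{m\to\infty}\ \inf_{Q\in\mathcal Q_{\text{1-gram}}}\mathcal L_m(Q\circ\operatorname{enc})\ \le\ \frac{1}{1-\varepsilon}\,H_\infty,\qquad \varepsilon=\frac{\log(1/\delta)}{0.99\,\log D}.$$ -/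

import Mathlib

open Filter MeasureTheory ProbabilityTheory
open scoped ENNReal

namespace ImageTok

variable {C : Type*} {m : ℕ}

/-- An `m × m` image of quantized patches; `x i j` is the patch in row `i` and column `j`. -/
abbrev Image (C : Type*) (m : ℕ) : Type _ := Fin m → Fin m → C

/-- The two ways of generating an image. -/
inductive Scenario
  | columnWise
  | rowWise

/-- The `k`-th column of the image, read from top to bottom, in the column-wise scenario; the
`k`-th row, read from left to right, in the row-wise scenario. -/
def Scenario.line (s : Scenario) (x : Image C m) (k : Fin m) : Fin m → C :=
  match s with
  | .columnWise => fun i => x i k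
  | .rowWise => fun j => x k j

/-- The probability that the chain with transition probabilities `P a b = P(b ∣ a)`, currently
at `a`, continues with the given string. -/
def transProb (P : Matrix C C ℝ) : C → List C → ℝ
  | _, [] => 1
  | a, b :: l => P a b * transProb P b l

/-- The probability that the chain with initial law `π` and transition probabilities `P` starts
with the given string. -/
def pathProb (π : C → ℝ) (P : Matrix C C ℝ) : List C → ℝ
  | [] => 1
  | a :: l => π a * transProb P a l

/-- The random image `X` follows scenario `s`: its lines (columns or rows) are independent, and
each is a Markov chain with transition probabilities `P` and initial law `π`. -/
structure Generates [MeasurableSpace C] (s : Scenario) (P : Matrix C C ℝ) (π : C → ℝ)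
    {Ω : Type*} [MeasurableSpace Ω] (μ : Measure Ω) (X : Ω → Image C m) : Prop where
  measurable : Measurable X
  indep : iIndepFun (fun (k : Fin m) ω => s.line (X ω) k) μ
  markov : ∀ (k : Fin m) (y : Fin m → C),
    μ.real {ω | s.line (X ω) k = y} = pathProb π P (List.ofFn y)

/-- `H_∞ = - ∑ₐ ∑ₐ' π(a) P(a' ∣ a) log P(a' ∣ a)`. -/
noncomputable def entropyRate [Fintype C] (P : Matrix C C ℝ) (π : C → ℝ) : ℝ :=
  -∑ a, ∑ a', π a * P a a' * Real.log (P a a')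

/-- A tokenizer: a finite dictionary of nonempty strings, and an encoding of strings as sequences
of tokens that is undone by concatenating the tokens. -/
structure Tokenizer (C : Type*) where
  dict : Finset (List C)
  ne_nil : ∀ t ∈ dict, t ≠ []
  enc : List C → List dict
  decode_enc : ∀ s : List C, ((enc s).map Subtype.val).flatten = s

/-- The encoding of an image: the concatenation of the encodings of its lines. -/
def Tokenizer.encImage (T : Tokenizer C) (s : Scenario) (x : Image C m) : List T.dict :=
  (List.ofFn fun k => T.enc (List.ofFn (s.line x k))).flatten

/-- A unigram model over the tokens `τ`. -/
structure Unigram (τ : Type*) where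
  len : PMF ℕ
  tok : PMF τ

/-- `Q(t) = Q_#(|t|) ∏ᵣ Q_tok(tᵣ)`. -/
noncomputable def Unigram.prob {τ : Type*} (Q : Unigram τ) (t : List τ) : ℝ≥0∞ :=
  Q.len t.length * (t.map Q.tok).prod

/-- `- log q` for a probability `q ≤ 1`, with value `∞` at `q = 0`. -/
noncomputable def negLog (q : ℝ≥0∞) : ℝ≥0∞ := (-ENNReal.log q).toENNReal

/-- The cross-entropy loss per patch, `- E[log Q(enc X)] / m²`, with values in `[0, ∞]`. -/
noncomputable def loss {τ : Type*} {Ω : Type*} [MeasurableSpace Ω] (μ : Measure Ω)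
    (X : Ω → Image C m) (enc : Image C m → List τ) (Q : Unigram τ) : ℝ≥0∞ :=
  (∫⁻ ω, negLog (Q.prob (enc (X ω))) ∂μ) / (m : ℝ≥0∞) ^ 2

end ImageTok

/-! A token is a letter followed by a leaf of the tree of its continuations, cut as soon as the
transition probability falls to `θ`. Every leaf then has probability between `δθ` and `θ`. The lower
bound limits the number of leaves, so that `θ = 2/(δ²D)` keeps the dictionary within `D`
(`card_treeDict_mul_le`). The upper bound makes each leaf carry information at least `log (1/θ)`,
which is close to `log D`.

Weighting tokens by their probability under the stationary chain makes a token cost its transition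
information plus about `log (1/δ)`, since `π ≥ δ`. The relative overhead `κ` is thus about `log
(1/δ) / log D`, and greedy parsing encodes a line at `1 + κ` times its transition information, plus
a bounded cost for the tail (`exists_parse`, `exists_tree_tokenizer`).

By stationarity the expected transition information of a line is at most `m * H_∞`
(`sum_pathProb_mul_transInfo`). The token count costs `log (m² + 1)` and the tails `O(m)`; both
vanish after division by `m²` (`iInf_loss_le`, `tendsto_overhead`). For large `D`, `κ ≤ ε`
(`overhead_le`), and `1 + ε ≤ 1/(1 - ε)`. -/

namespace ImageTok

section Codebook

variable {C : Type*}

/-! ### Injectivity of the image encoding -/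

theorem Tokenizer.decode_encImage (T : Tokenizer C) (s : Scenario) {m : ℕ} (x : Image C m) :
    ((T.encImage s x).map Subtype.val).flatten
      = (List.ofFn fun k => List.ofFn (s.line x k)).flatten := by
  rw [Tokenizer.encImage, List.map_flatten, List.map_ofFn, List.flatten_flatten, List.map_ofFn]
  congr 2
  funext k
  exact T.decode_enc _

/-- All lines have length `m`, so the concatenation determines where to cut. -/
theorem ofFn_flatten_injective {m : ℕ} :
    Function.Injective fun x : Fin m → Fin m → C =>
      (List.ofFn fun k => List.ofFn (x k)).flatten := by
  intro x y h
  have h' := List.eq_iff_flatten_eq (L := List.ofFn fun k => List.ofFn (x k))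
    (L' := List.ofFn fun k => List.ofFn (y k)) |>.2 ⟨h, by
      simp [List.map_ofFn, Function.comp_def]⟩
  funext k
  exact List.ofFn_injective (congrFun (List.ofFn_injective h') k)

theorem Scenario.line_injective (s : Scenario) {m : ℕ} :
    Function.Injective (s.line : Image C m → Fin m → Fin m → C) := by
  intro x y h
  cases s with
  | columnWise => funext i k; exact congrFun (congrFun h k) i
  | rowWise => exact h

theorem Tokenizer.encImage_injective (T : Tokenizer C) (s : Scenario) {m : ℕ} :
    Function.Injective (T.encImage s : Image C m → List T.dict) := by
  intro x y h
  apply s.line_injective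
  apply ofFn_flatten_injective
  simp only [← T.decode_encImage, h]

/-! ### Transition probabilities and information of strings -/

/-- The information content of the transitions in a string. -/
noncomputable def transInfo (P : Matrix C C ℝ) : List C → ℝ
  | [] => 0
  | a :: l => -Real.log (transProb P a l)

theorem transProb_pos {P : Matrix C C ℝ} (hP : ∀ a b, 0 < P a b) (a : C) (l : List C) :
    0 < transProb P a l := by
  induction l generalizing a with
  | nil => exact one_pos
  | cons b l ih => exact mul_pos (hP a b) (ih b)

theorem transProb_le_one {P : Matrix C C ℝ} (hP : ∀ a b, 0 < P a b) (hP1 : ∀ a b, P a b ≤ 1)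
    (a : C) (l : List C) : transProb P a l ≤ 1 := by
  induction l generalizing a with
  | nil => exact le_rfl
  | cons b l ih => exact mul_le_one₀ (hP1 a b) (transProb_pos hP b l).le (ih b)

theorem pathProb_pos {P : Matrix C C ℝ} {π : C → ℝ} (hP : ∀ a b, 0 < P a b)
    (hπ : ∀ a, 0 < π a) (t : List C) : 0 < pathProb π P t := by
  cases t with
  | nil => exact one_pos
  | cons a l => exact mul_pos (hπ a) (transProb_pos hP a l)

theorem transInfo_nonneg {P : Matrix C C ℝ} (hP : ∀ a b, 0 < P a b) (hP1 : ∀ a b, P a b ≤ 1)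
    (l : List C) : 0 ≤ transInfo P l := by
  cases l with
  | nil => exact le_rfl
  | cons a l =>
    exact neg_nonneg.2 (Real.log_nonpos (transProb_pos hP a l).le (transProb_le_one hP hP1 a l))

theorem transProb_append_cons_le {P : Matrix C C ℝ} (hP : ∀ a b, 0 < P a b)
    (hP1 : ∀ a b, P a b ≤ 1) (a b : C) (l r : List C) :
    transProb P a (l ++ b :: r) ≤ transProb P a l * transProb P b r := by
  induction l generalizing a with
  | nil =>
    simpa [transProb] using mul_le_of_le_one_left (transProb_pos hP b r).le (hP1 a b)
  | cons c l ih =>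
    simp only [List.cons_append, transProb, mul_assoc]
    exact mul_le_mul_of_nonneg_left (ih c) (hP a c).le

/-- Cutting a string drops the transition across the cut, a factor of at most 1. Hence the
information of the tokens adds up to at most that of the line. -/
theorem transInfo_add_le {P : Matrix C C ℝ} (hP : ∀ a b, 0 < P a b) (hP1 : ∀ a b, P a b ≤ 1)
    (a : C) (l r : List C) :
    -Real.log (transProb P a l) + transInfo P r ≤ -Real.log (transProb P a (l ++ r)) := by
  cases r with
  | nil => simp [transInfo]
  | cons b r =>
    have h := Real.log_le_log (transProb_pos hP _ _) (transProb_append_cons_le hP hP1 a b l r)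
    rw [Real.log_mul (transProb_pos hP _ _).ne' (transProb_pos hP _ _).ne'] at h
    simp only [transInfo]
    linarith

/-! ### Probability trees and greedy parsing -/

section Tree

variable [Fintype C] [DecidableEq C]

/-- The strings that consist of a letter `b` followed by an element of `S b`. -/
def consUnion (S : C → Finset (List C)) : Finset (List C) :=
  Finset.univ.biUnion fun b => (S b).image (List.cons b)

theorem cons_mem_consUnion {S : C → Finset (List C)} {b : C} {l : List C} :
    b :: l ∈ consUnion S ↔ l ∈ S b := by
  simp [consUnion]

theorem mem_consUnion {S : C → Finset (List C)} {t : List C} :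
    t ∈ consUnion S ↔ ∃ b, ∃ l ∈ S b, b :: l = t := by
  simp [consUnion]

theorem sum_consUnion (S : C → Finset (List C)) (f : List C → ℝ) :
    ∑ t ∈ consUnion S, f t = ∑ b, ∑ l ∈ S b, f (b :: l) := by
  rw [consUnion, Finset.sum_biUnion]
  · refine Finset.sum_congr rfl fun b _ => Finset.sum_image ?_
    intro x _ y _ h
    exact (List.cons.inj h).2
  · intro b _ c _ hbc
    refine Finset.disjoint_left.2 fun t hb hc => hbc ?_
    obtain ⟨l, -, rfl⟩ := Finset.mem_image.1 hb
    obtain ⟨r, -, h⟩ := Finset.mem_image.1 hc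
    exact (List.cons.inj h).1.symm

/-- The leaves of the tree of continuations of a string with last letter `a` and probability `p`,
which is cut where the probability falls to `θ` and, at the latest, at depth `n`. -/
noncomputable def leaves (P : Matrix C C ℝ) (θ : ℝ) : ℕ → ℝ → C → Finset (List C)
  | 0, _, _ => {[]}
  | n + 1, p, a =>
    if p ≤ θ then {[]} else consUnion fun b => leaves P θ n (p * P a b) b

variable {P : Matrix C C ℝ} {θ : ℝ}

/-- Stopping at a node keeps its mass; expanding it distributes the mass among its children. -/
theorem sum_leaves (hsum : ∀ a, ∑ b, P a b = 1) (n : ℕ) (p : ℝ) (a : C) :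
    ∑ l ∈ leaves P θ n p a, transProb P a l = 1 := by
  induction n generalizing p a with
  | zero => simp [leaves, transProb]
  | succ n ih =>
    rw [leaves]
    split_ifs
    · simp [transProb]
    · simp only [sum_consUnion, transProb, ← Finset.mul_sum, ih, mul_one, hsum]

/-- A node is expanded only above `θ`, and one more letter costs a factor of at least `δ`. -/
theorem le_of_mem_leaves {δ : ℝ} (hδ : ∀ a b, δ ≤ P a b) (hδ0 : 0 < δ) (hθ : 0 < θ) {n : ℕ}
    {p : ℝ} {a : C} {l : List C} (hp : δ * θ ≤ p) (hl : l ∈ leaves P θ n p a) :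
    δ * θ ≤ p * transProb P a l := by
  induction n generalizing p a l with
  | zero =>
    obtain rfl : l = [] := by simpa [leaves] using hl
    simpa [transProb] using hp
  | succ n ih =>
    rw [leaves] at hl
    split_ifs at hl with h
    · obtain rfl : l = [] := by simpa using hl
      simpa [transProb] using hp
    · obtain ⟨b, r, hr, rfl⟩ := mem_consUnion.1 hl
      rw [transProb, ← mul_assoc]
      refine ih ?_ hr
      rw [mul_comm]
      exact mul_le_mul (not_le.1 h).le (hδ a b) hδ0.le (hθ.trans (not_le.1 h)).le

/-- If `n` factors of `ρ` bring the probability down to `θ`, the depth bound never cuts a branch too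
early. -/
theorem mem_leaves_le {ρ : ℝ} (hP : ∀ a b, 0 < P a b) (hρ : ∀ a b, P a b ≤ ρ) (hρ0 : 0 ≤ ρ) {n : ℕ}
    {p : ℝ} {a : C} {l : List C} (hp0 : 0 ≤ p) (hp : p * ρ ^ n ≤ θ) (hl : l ∈ leaves P θ n p a) :
    p * transProb P a l ≤ θ := by
  induction n generalizing p a l with
  | zero =>
    obtain rfl : l = [] := by simpa [leaves] using hl
    simpa [transProb] using hp
  | succ n ih =>
    rw [leaves] at hl
    split_ifs at hl with h
    · obtain rfl : l = [] := by simpa using hl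
      simpa [transProb] using h
    · obtain ⟨b, r, hr, rfl⟩ := mem_consUnion.1 hl
      rw [transProb, ← mul_assoc]
      refine ih (mul_nonneg hp0 (hP a b).le) ?_ hr
      refine le_trans ?_ hp
      rw [pow_succ', mul_assoc]
      gcongr
      exact hρ a b

theorem exists_append_mem_leaves (n : ℕ) (p : ℝ) (a : C) (s : List C) :
    (∃ l r, s = l ++ r ∧ l ∈ leaves P θ n p a) ∨ s.length < n := by
  induction n generalizing p a s with
  | zero => exact .inl ⟨[], s, rfl, by simp [leaves]⟩
  | succ n ih =>
    by_cases h : p ≤ θ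
    · exact .inl ⟨[], s, rfl, by simp [leaves, h]⟩
    · cases s with
      | nil => exact .inr (by simp)
      | cons b s =>
        rcases ih (p * P a b) b s with ⟨l, r, rfl, hl⟩ | hs
        · refine .inl ⟨b :: l, r, rfl, ?_⟩
          rw [leaves, if_neg h]
          exact cons_mem_consUnion.2 hl
        · exact .inr (by simpa using hs)

theorem card_leaves_mul_le {δ : ℝ} (hsum : ∀ a, ∑ b, P a b = 1) (hδ : ∀ a b, δ ≤ P a b)
    (hδ0 : 0 < δ) (hθ : 0 < θ) (h1 : δ * θ ≤ 1) (n : ℕ) (a : C) :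
    (leaves P θ n 1 a).card * (δ * θ) ≤ 1 := by
  refine le_of_le_of_eq ?_ (sum_leaves (θ := θ) hsum n 1 a)
  rw [← nsmul_eq_mul]
  refine Finset.card_nsmul_le_sum _ (transProb P a) (δ * θ) fun l hl => ?_
  simpa using le_of_mem_leaves hδ hδ0 hθ h1 hl

theorem exists_parse {A : Finset (List C)} {c : List C → ℝ} {κ K θ : ℝ} {n : ℕ}
    (hP : ∀ a b, 0 < P a b) (hP1 : ∀ a b, P a b ≤ 1) (hκ : 0 ≤ κ)
    (hK : 0 ≤ K) (hsingle : ∀ a, [a] ∈ A) (hcsingle : ∀ a, c [a] ≤ K)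
    (hleaf : ∀ a, ∀ l ∈ leaves P θ n 1 a, a :: l ∈ A)
    (hcleaf : ∀ a, ∀ l ∈ leaves P θ n 1 a, c (a :: l) ≤ κ * -Real.log (transProb P a l))
    (s : List C) :
    ∃ ts : List (List C), (∀ t ∈ ts, t ∈ A) ∧ ts.flatten = s ∧
      (ts.map c).sum ≤ κ * transInfo P s + n * K := by
  have hnK : (0 : ℝ) ≤ n * K := by positivity
  induction hs : s.length using Nat.strong_induction_on generalizing s with
  | _ N ih =>
    cases s with
    | nil => exact ⟨[], by simp, rfl, by simpa [transInfo] using hnK⟩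
    | cons a s =>
      rcases exists_append_mem_leaves (P := P) (θ := θ) n 1 a s with ⟨l, r, rfl, hl⟩ | hlen
      · obtain ⟨ts, hts, hflat, hsum⟩ := ih r.length (by subst hs; simp) r rfl
        refine ⟨(a :: l) :: ts, ?_, by simp [hflat], ?_⟩
        · rintro t (_ | ⟨_, ht⟩)
          · exact hleaf a l hl
          · exact hts _ ht
        · have h1 := hcleaf a l hl
          have h2 := mul_le_mul_of_nonneg_left (transInfo_add_le hP hP1 a l r) hκ
          simp only [List.map_cons, List.sum_cons, transInfo] at *
          linarith
      -- The string ends inside the tree. This happens only once, at the end of the parse, and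
      -- leaves at most `n` letters, spelled out singly.
      · refine ⟨(a :: s).map fun b => [b], ?_, ?_, ?_⟩
        · intro t ht
          obtain ⟨b, -, rfl⟩ := List.mem_map.1 ht
          exact hsingle b
        · exact (List.flatMap_def ..).symm.trans (List.flatMap_singleton' _)
        · have h1 : (((a :: s).map fun b => [b]).map c).sum ≤ (a :: s).length • K := by
            have := List.sum_le_card_nsmul (((a :: s).map fun b => [b]).map c) K (by
              intro x hx
              simp only [List.map_map, List.mem_map, Function.comp] at hx
              obtain ⟨b, -, rfl⟩ := hx
              exact hcsingle b)
            simpa using this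
          have h2 : (((a :: s).length : ℕ) : ℝ) * K ≤ n * K :=
            mul_le_mul_of_nonneg_right (by exact_mod_cast hlen) hK
          rw [nsmul_eq_mul] at h1
          have h3 := mul_nonneg hκ (transInfo_nonneg hP hP1 (a :: s))
          linarith

end Tree

/-! ### Expected information of a stationary line -/

section Entropy

variable [Fintype C] {P : Matrix C C ℝ}

theorem sum_fin_succ_fun {n : ℕ} (f : (Fin (n + 1) → C) → ℝ) :
    ∑ y, f y = ∑ a, ∑ z : Fin n → C, f (Fin.cons a z) := by
  rw [← (Fin.consEquiv fun _ => C).sum_comp, Fintype.sum_prod_type]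
  rfl

theorem sum_transProb (hsum : ∀ a, ∑ b, P a b = 1) (n : ℕ) (a : C) :
    ∑ z : Fin n → C, transProb P a (List.ofFn z) = 1 := by
  induction n generalizing a with
  | zero => simp [transProb]
  | succ n ih =>
    simp [sum_fin_succ_fun, List.ofFn_succ, transProb, ← Finset.mul_sum, ih, hsum]

theorem sum_transProb_mul_log (hP : ∀ a b, 0 < P a b) (hsum : ∀ a, ∑ b, P a b = 1)
    (n : ℕ) (a : C) :
    ∑ z : Fin (n + 1) → C, transProb P a (List.ofFn z) * Real.log (transProb P a (List.ofFn z))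
      = ∑ b, P a b * Real.log (P a b) + ∑ b, P a b * ∑ z : Fin n → C,
          transProb P b (List.ofFn z) * Real.log (transProb P b (List.ofFn z)) := by
  rw [sum_fin_succ_fun, ← Finset.sum_add_distrib]
  refine Finset.sum_congr rfl fun b _ => ?_
  have h : ∀ z : Fin n → C,
      transProb P a (List.ofFn (Fin.cons b z : Fin (n + 1) → C))
        * Real.log (transProb P a (List.ofFn (Fin.cons b z : Fin (n + 1) → C)))
      = P a b * Real.log (P a b) * transProb P b (List.ofFn z)
        + P a b * (transProb P b (List.ofFn z) * Real.log (transProb P b (List.ofFn z))) := by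
    intro z
    simp only [List.ofFn_succ, Fin.cons_zero, Fin.cons_succ, transProb]
    rw [Real.log_mul (hP a b).ne' (transProb_pos hP _ _).ne']
    ring
  simp only [h, Finset.sum_add_distrib, ← Finset.mul_sum, sum_transProb hsum, mul_one]

theorem sum_pathProb_mul_transInfo {π : C → ℝ} (hP : ∀ a b, 0 < P a b)
    (hsum : ∀ a, ∑ b, P a b = 1) (hπ : Matrix.vecMul π P = π) (n : ℕ) :
    ∑ y : Fin (n + 1) → C, pathProb π P (List.ofFn y) * transInfo P (List.ofFn y)
      = n * entropyRate P π := by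
  have key : ∀ n : ℕ, ∑ a, π a * ∑ z : Fin n → C,
      transProb P a (List.ofFn z) * Real.log (transProb P a (List.ofFn z))
      = -(n * entropyRate P π) := by
    intro n
    induction n with
    | zero => simp [transProb]
    | succ n ih =>
      simp only [sum_transProb_mul_log hP hsum, mul_add, Finset.sum_add_distrib]
      -- Stationarity: one step of the chain preserves the law `π`.
      have h : ∀ g : C → ℝ, ∑ a, π a * ∑ b, P a b * g b = ∑ b, π b * g b := by
        intro g
        simp only [Finset.mul_sum]
        rw [Finset.sum_comm]
        refine Finset.sum_congr rfl fun b _ => ?_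
        conv_rhs => rw [← hπ]
        simp only [Matrix.vecMul, dotProduct, Finset.sum_mul, mul_assoc]
      rw [h, ih, entropyRate]
      simp only [Finset.mul_sum, mul_assoc]
      push_cast
      ring
  rw [sum_fin_succ_fun, ← neg_eq_iff_eq_neg.2 (key n)]
  rw [← Finset.sum_neg_distrib]
  refine Finset.sum_congr rfl fun a _ => ?_
  rw [Finset.mul_sum, ← Finset.sum_neg_distrib]
  refine Finset.sum_congr rfl fun z _ => ?_
  simp only [List.ofFn_succ, Fin.cons_zero, Fin.cons_succ, pathProb, transInfo]
  ring

theorem entropyRate_nonneg {π : C → ℝ} (hP : ∀ a b, 0 < P a b) (hP1 : ∀ a b, P a b ≤ 1)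
    (hπ : ∀ a, 0 ≤ π a) : 0 ≤ entropyRate P π := by
  rw [entropyRate, neg_nonneg]
  exact Finset.sum_nonpos fun a _ => Finset.sum_nonpos fun b _ =>
    mul_nonpos_of_nonneg_of_nonpos (mul_nonneg (hπ a) (hP a b).le)
      (Real.log_nonpos (hP a b).le (hP1 a b))

end Entropy

end Codebook

/-! ### Code lengths and the loss of a unigram model -/

theorem negLog_le {x : ℝ} (hx : 0 < x) {q : ℝ≥0∞} (h : ENNReal.ofReal x ≤ q) :
    negLog q ≤ ENNReal.ofReal (-Real.log x) := by
  have h1 := ENNReal.log_le_log h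
  rw [ENNReal.log_ofReal_of_pos hx] at h1
  calc negLog q ≤ (-(Real.log x : EReal)).toENNReal :=
        EReal.toENNReal_le_toENNReal (EReal.neg_le_neg_iff.2 h1)
    _ = ENNReal.ofReal (-Real.log x) := by
        rw [← EReal.coe_neg, EReal.toENNReal_of_ne_top (EReal.coe_ne_top _), EReal.toReal_coe]

theorem Unigram.negLog_prob_le {τ : Type*} (Q : Unigram τ) {c : τ → ℝ} {b : ℝ}
    (hc : ∀ t, ENNReal.ofReal (Real.exp (-c t)) ≤ Q.tok t) {t : List τ}
    (hb : ENNReal.ofReal (Real.exp (-b)) ≤ Q.len t.length) :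
    negLog (Q.prob t) ≤ ENNReal.ofReal (b + (t.map c).sum) := by
  have h : ENNReal.ofReal (Real.exp (-(t.map c).sum)) ≤ (t.map Q.tok).prod := by
    clear hb
    induction t with
    | nil => simp
    | cons a t ih =>
      simp only [List.map_cons, List.sum_cons, List.prod_cons, neg_add, Real.exp_add]
      rw [ENNReal.ofReal_mul (Real.exp_pos _).le]
      exact mul_le_mul' (hc a) ih
  have h' : ENNReal.ofReal (Real.exp (-(b + (t.map c).sum))) ≤ Q.prob t := by
    rw [neg_add, Real.exp_add, ENNReal.ofReal_mul (Real.exp_pos _).le]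
    exact mul_le_mul' hb h
  simpa using negLog_le (Real.exp_pos _) h'

/-- Normalizing weights of total at most 1 can only increase them. -/
theorem exists_pmf_ge {τ : Type*} [Fintype τ] [Nonempty τ] (q : τ → ℝ) (hq : ∀ t, 0 < q t)
    (hsum : ∑ t, q t ≤ 1) : ∃ Q : PMF τ, ∀ t, ENNReal.ofReal (q t) ≤ Q t := by
  have htsum : ∑' t, ENNReal.ofReal (q t) = ENNReal.ofReal (∑ t, q t) := by
    rw [tsum_fintype, ENNReal.ofReal_sum_of_nonneg fun t _ => (hq t).le]
  have hpos : 0 < ∑ t, q t := Finset.sum_pos (fun t _ => hq t) Finset.univ_nonempty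
  refine ⟨PMF.normalize (fun t => ENNReal.ofReal (q t)) ?_ ?_, fun t => ?_⟩
  · rw [htsum]
    exact (ENNReal.ofReal_pos.2 hpos).ne'
  · rw [htsum]
    exact ENNReal.ofReal_ne_top
  · rw [PMF.normalize_apply, htsum]
    refine le_mul_of_one_le_right' (ENNReal.one_le_inv.2 ?_)
    exact ENNReal.ofReal_le_one.2 hsum

theorem length_le_length_flatten {α : Type*} (L : List (List α)) (h : ∀ l ∈ L, l ≠ []) :
    L.length ≤ L.flatten.length := by
  induction L with
  | nil => simp
  | cons a L ih =>
    have h1 := List.length_pos_of_ne_nil (h a (by simp))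
    have h2 := ih fun l hl => h l (by simp [hl])
    simp only [List.length_cons, List.flatten_cons, List.length_append]
    omega

variable {C : Type*}

theorem Tokenizer.length_encImage_le (T : Tokenizer C) (s : Scenario) {m : ℕ} (x : Image C m) :
    (T.encImage s x).length ≤ m ^ 2 := by
  have h := length_le_length_flatten ((T.encImage s x).map Subtype.val) (by
    intro l hl
    obtain ⟨t, -, rfl⟩ := List.mem_map.1 hl
    exact T.ne_nil _ t.2)
  rw [T.decode_encImage] at h
  simpa [List.length_flatten, List.map_ofFn, Function.comp_def, List.sum_ofFn, sq] using h

theorem exists_tokenizer (A : Finset (List C)) (hA : ∀ t ∈ A, t ≠ []) (c : List C → ℝ)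
    (B : List C → ℝ) (h : ∀ s, ∃ ts : List (List C), (∀ t ∈ ts, t ∈ A) ∧ ts.flatten = s ∧
      (ts.map c).sum ≤ B s) :
    ∃ T : Tokenizer C, T.dict = A ∧ ∀ s, ((T.enc s).map fun t : T.dict => c t).sum ≤ B s := by
  choose enc hmem hflat hB using h
  refine ⟨⟨A, hA, fun s => (enc s).attachWith (· ∈ A) (hmem s), fun s => ?_⟩, rfl, fun s => ?_⟩
  · simp [hflat]
  · refine le_of_eq_of_le ?_ (hB s)
    rw [show (fun t : A => c t) = c ∘ Subtype.val from rfl, ← List.map_map,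
      List.attachWith_map_subtype_val]

theorem Scenario.measurable_line [MeasurableSpace C] (s : Scenario) {m : ℕ} (k : Fin m) :
    Measurable fun x : Image C m => s.line x k := by
  cases s with
  | columnWise =>
    exact measurable_pi_lambda _ fun i => (measurable_pi_apply k).comp (measurable_pi_apply i)
  | rowWise => exact measurable_pi_apply k

theorem Generates.lintegral_line [Fintype C] [MeasurableSpace C] [MeasurableSingletonClass C]
    {s : Scenario} {P : Matrix C C ℝ} {π : C → ℝ} {Ω : Type*} [MeasurableSpace Ω]
    {μ : Measure Ω} [IsFiniteMeasure μ] {m : ℕ} {X : Ω → Image C m} (hX : Generates s P π μ X)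
    (k : Fin m) (g : (Fin m → C) → ℝ) (hg : ∀ y, 0 ≤ g y) :
    ∫⁻ ω, ENNReal.ofReal (g (s.line (X ω) k)) ∂μ
      = ENNReal.ofReal (∑ y, pathProb π P (List.ofFn y) * g y) := by
  classical
  have hY : Measurable fun ω => s.line (X ω) k := (s.measurable_line k).comp hX.measurable
  rw [← lintegral_map (f := fun y => ENNReal.ofReal (g y)) (.of_discrete) hY, lintegral_fintype]
  have h : ∀ y, (μ.map fun ω => s.line (X ω) k) {y}
      = ENNReal.ofReal (pathProb π P (List.ofFn y)) := by
    intro y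
    rw [Measure.map_apply hY (measurableSet_singleton y), ← hX.markov k y, ofReal_measureReal]
    rfl
  have h0 : ∀ y : Fin m → C, 0 ≤ pathProb π P (List.ofFn y) := fun y => by
    rw [← hX.markov k y]
    exact measureReal_nonneg
  rw [ENNReal.ofReal_sum_of_nonneg fun y _ => mul_nonneg (h0 y) (hg y)]
  refine Finset.sum_congr rfl fun y _ => ?_
  rw [h, ENNReal.ofReal_mul (h0 y), mul_comm]

theorem iInf_loss_le [Fintype C] [MeasurableSpace C] [MeasurableSingletonClass C]
    {s : Scenario} {P : Matrix C C ℝ} {π : C → ℝ} {Ω : Type*} [MeasurableSpace Ω]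
    {μ : Measure Ω} [IsProbabilityMeasure μ] {m : ℕ} {X : Ω → Image C m}
    (hX : Generates s P π μ X) (hm : 0 < m)
    (hP : ∀ a b, 0 < P a b) (hsum : ∀ a, ∑ b, P a b = 1) (hP1 : ∀ a b, P a b ≤ 1)
    (hπ0 : ∀ a, 0 ≤ π a) (hπ : Matrix.vecMul π P = π) (T : Tokenizer C) (Q : PMF T.dict)
    {c : T.dict → ℝ} {κ K : ℝ} (hκ : 0 ≤ κ) (hK : 0 ≤ K)
    (hQ : ∀ t, ENNReal.ofReal (Real.exp (-c t)) ≤ Q t)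
    (hc : ∀ l, ((T.enc l).map c).sum ≤ κ * transInfo P l + K) :
    ⨅ Q : Unigram T.dict, loss μ X (T.encImage s) Q
      ≤ ENNReal.ofReal (κ * entropyRate P π + (Real.log (m ^ 2 + 1) / m ^ 2 + K / m)) := by
  have hH := entropyRate_nonneg hP hP1 hπ0
  have hm' : (0 : ℝ) < m := by exact_mod_cast hm
  have hlog : 0 ≤ Real.log ((m : ℝ) ^ 2 + 1) := Real.log_nonneg (by nlinarith)
  -- Tokens are nonempty, so their number is at most `m ^ 2`; a uniform length law then costs `log
  -- (m ^ 2 + 1)`.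
  let U : Unigram T.dict :=
    ⟨PMF.uniformOfFinset (Finset.range (m ^ 2 + 1)) Finset.nonempty_range_add_one, Q⟩
  have hpt : ∀ x : Image C m, negLog (U.prob (T.encImage s x))
      ≤ ENNReal.ofReal (Real.log ((m : ℝ) ^ 2 + 1) + m * K)
        + ∑ k, ENNReal.ofReal (κ * transInfo P (List.ofFn (s.line x k))) := by
    intro x
    have h1 : ENNReal.ofReal (Real.exp (-Real.log ((m : ℝ) ^ 2 + 1)))
        ≤ U.len (T.encImage s x).length := by
      have hmem : (T.encImage s x).length ∈ Finset.range (m ^ 2 + 1) :=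
        Finset.mem_range_succ_iff.2 (T.length_encImage_le s x)
      rw [PMF.uniformOfFinset_apply_of_mem _ hmem, Finset.card_range, Real.exp_neg,
        Real.exp_log (by positivity), ENNReal.ofReal_inv_of_pos (by positivity)]
      refine ENNReal.inv_le_inv.2 (le_of_eq ?_)
      rw [← ENNReal.ofReal_natCast]
      push_cast
      rfl
    refine (U.negLog_prob_le hQ h1).trans ?_
    have h0 : ∀ k ∈ (Finset.univ : Finset (Fin m)),
        0 ≤ κ * transInfo P (List.ofFn (s.line x k)) :=
      fun k _ => mul_nonneg hκ (transInfo_nonneg hP hP1 _)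
    rw [← ENNReal.ofReal_sum_of_nonneg h0,
      ← ENNReal.ofReal_add (by positivity) (Finset.sum_nonneg h0)]
    refine ENNReal.ofReal_le_ofReal ?_
    have h2 : ((T.encImage s x).map c).sum
        = ∑ k, ((T.enc (List.ofFn (s.line x k))).map c).sum := by
      rw [Tokenizer.encImage, List.map_flatten, List.sum_flatten, List.map_ofFn, List.map_ofFn,
        List.sum_ofFn]
      rfl
    have h3 := Finset.sum_le_sum fun (k : Fin m) (_ : k ∈ Finset.univ) =>
      hc (List.ofFn (s.line x k))
    rw [Finset.sum_add_distrib, Finset.sum_const, Finset.card_univ, Fintype.card_fin,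
      nsmul_eq_mul] at h3
    linarith
  have hline : ∀ k, ∫⁻ ω, ENNReal.ofReal (κ * transInfo P (List.ofFn (s.line (X ω) k))) ∂μ
      ≤ ENNReal.ofReal (κ * (m * entropyRate P π)) := by
    intro k
    rw [hX.lintegral_line k (fun y => κ * transInfo P (List.ofFn y))
      fun y => mul_nonneg hκ (transInfo_nonneg hP hP1 _)]
    refine ENNReal.ofReal_le_ofReal ?_
    simp only [mul_left_comm _ κ, ← Finset.mul_sum]
    refine mul_le_mul_of_nonneg_left ?_ hκ
    obtain ⟨n, rfl⟩ : ∃ n, m = n + 1 := ⟨m - 1, by omega⟩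
    rw [sum_pathProb_mul_transInfo hP hsum hπ]
    push_cast
    nlinarith
  have hmeas : ∀ k, Measurable fun ω =>
      ENNReal.ofReal (κ * transInfo P (List.ofFn (s.line (X ω) k))) := fun k =>
    (Measurable.of_discrete (f := fun y : Fin m → C =>
      ENNReal.ofReal (κ * transInfo P (List.ofFn y)))).comp
      ((s.measurable_line k).comp hX.measurable)
  refine (iInf_le _ U).trans ?_
  have hint : ∫⁻ ω, negLog (U.prob (T.encImage s (X ω))) ∂μ
      ≤ ENNReal.ofReal (Real.log ((m : ℝ) ^ 2 + 1) + m * K + m * (κ * (m * entropyRate P π))) := by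
    refine (lintegral_mono fun ω => hpt (X ω)).trans ?_
    rw [lintegral_add_left measurable_const, lintegral_const, measure_univ, mul_one,
      lintegral_finsetSum _ fun k _ => hmeas k,
      ENNReal.ofReal_add (p := Real.log ((m : ℝ) ^ 2 + 1) + m * K) (by positivity) (by positivity)]
    refine add_le_add le_rfl ((Finset.sum_le_sum fun k _ => hline k).trans (le_of_eq ?_))
    rw [Finset.sum_const, Finset.card_univ, Fintype.card_fin, nsmul_eq_mul,
      ENNReal.ofReal_mul hm'.le, ENNReal.ofReal_natCast]
  rw [loss]
  refine (ENNReal.div_le_div_right hint _).trans (le_of_eq ?_)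
  rw [← ENNReal.ofReal_natCast, ← ENNReal.ofReal_pow hm'.le,
    ← ENNReal.ofReal_div_of_pos (by positivity)]
  congr 1
  field_simp
  ring

theorem tendsto_overhead (h K : ℝ) :
    Tendsto (fun m : ℕ => ENNReal.ofReal (h + (Real.log ((m : ℝ) ^ 2 + 1) / m ^ 2 + K / m)))
      atTop (nhds (ENNReal.ofReal h)) := by
  refine (ENNReal.continuous_ofReal.tendsto h).comp ?_
  have h1 : Tendsto (fun m : ℕ => K / (m : ℝ)) atTop (nhds 0) :=
    tendsto_const_div_atTop_nhds_zero_nat K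
  have h2 : Tendsto (fun m : ℕ => Real.log ((m : ℝ) ^ 2 + 1) / m ^ 2) atTop (nhds 0) := by
    have hx : Tendsto (fun m : ℕ => (m : ℝ) ^ 2 + 1) atTop atTop :=
      tendsto_atTop_add_const_right _ _
        ((tendsto_pow_atTop two_ne_zero).comp tendsto_natCast_atTop_atTop)
    -- The factor 2 pays for replacing `m ^ 2 + 1` by `m ^ 2` in the denominator, as `m ^ 2 + 1 ≤ 2
    -- * m ^ 2` for `m ≥ 1`.
    have := ((Real.isLittleO_log_id_atTop.comp_tendsto hx).tendsto_div_nhds_zero).mul_const 2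
    rw [zero_mul] at this
    refine squeeze_zero' (Eventually.of_forall fun m => ?_) ?_ this
    · exact div_nonneg (Real.log_nonneg (by nlinarith [sq_nonneg (m : ℝ)])) (by positivity)
    · filter_upwards [eventually_ge_atTop 1] with m hm
      have hm' : (1 : ℝ) ≤ m := by exact_mod_cast hm
      have hl : 0 ≤ Real.log ((m : ℝ) ^ 2 + 1) := Real.log_nonneg (by nlinarith)
      simp only [Function.comp, id]
      rw [div_mul_eq_mul_div, div_le_div_iff₀ (by positivity) (by positivity)]
      nlinarith [mul_nonneg hl (by nlinarith : (0 : ℝ) ≤ (m : ℝ) ^ 2 - 1)]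
  simpa using (h2.add h1).const_add h

/-! ### The dictionary, its weights and the tokenizer -/

theorem card_consUnion [Fintype C] [DecidableEq C] (S : C → Finset (List C)) :
    ((consUnion S).card : ℝ) = ∑ b, ((S b).card : ℝ) := by
  simpa using sum_consUnion S fun _ => 1

/-- The dictionary that consists of the leaves of the trees rooted at the letters, and of the
single letters. -/
noncomputable def treeDict [Fintype C] [DecidableEq C] (P : Matrix C C ℝ) (θ : ℝ) (n : ℕ) :
    Finset (List C) :=
  consUnion (leaves P θ n 1) ∪ consUnion fun _ => {[]}

theorem card_treeDict_mul_le [Fintype C] [DecidableEq C] {P : Matrix C C ℝ} {δ θ : ℝ}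
    (hsum : ∀ a, ∑ b, P a b = 1) (hδ : ∀ a b, δ ≤ P a b) (hδ0 : 0 < δ) (hθ : 0 < θ)
    (h1 : δ * θ ≤ 1) (hcard : Fintype.card C * δ ≤ 1) (n : ℕ) :
    (treeDict P θ n).card * (δ ^ 2 * θ) ≤ 2 := by
  have hle : ((treeDict P θ n).card : ℝ)
      ≤ (consUnion (leaves P θ n 1)).card + (consUnion fun _ : C => {[]}).card := by
    exact_mod_cast Finset.card_union_le _ _
  have hleaves : (consUnion (leaves P θ n 1)).card * (δ * θ) ≤ Fintype.card C := by
    rw [card_consUnion, Finset.sum_mul]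
    refine (Finset.sum_le_sum fun a _ =>
      card_leaves_mul_le hsum hδ hδ0 hθ h1 n a).trans (le_of_eq ?_)
    simp
  have hsingle : ((consUnion fun _ : C => {[]}).card : ℝ) = Fintype.card C := by
    rw [card_consUnion]
    simp
  rw [hsingle] at hle
  calc ((treeDict P θ n).card : ℝ) * (δ ^ 2 * θ)
      ≤ ((consUnion (leaves P θ n 1)).card + Fintype.card C) * (δ ^ 2 * θ) := by gcongr
    _ = (consUnion (leaves P θ n 1)).card * (δ * θ) * δ
          + Fintype.card C * δ * (δ * θ) := by ring
    _ ≤ Fintype.card C * δ + 1 * (δ * θ) := by gcongr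
    _ ≤ 2 := by linarith

/-- The weights of the tokens: the leaves and the single letters share the total weight in the
proportion `1 - η` to `η`, and in either part a string is weighted by its probability. -/
noncomputable def treeWeight [Fintype C] [DecidableEq C] (P : Matrix C C ℝ) (π : C → ℝ)
    (θ η : ℝ) (n : ℕ) (t : List C) : ℝ :=
  (if t ∈ consUnion (leaves P θ n 1) then (1 - η) * pathProb π P t else 0)
    + if t ∈ consUnion (fun _ => {[]}) then η * pathProb π P t else 0

section TreeWeight

variable [Fintype C] [DecidableEq C] {P : Matrix C C ℝ} {π : C → ℝ} {θ η : ℝ} {n : ℕ}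

theorem sum_treeWeight (hsum : ∀ a, ∑ b, P a b = 1) (hπ1 : ∑ a, π a = 1) :
    ∑ t ∈ treeDict P θ n, treeWeight P π θ η n t = 1 := by
  simp only [treeWeight, Finset.sum_add_distrib, Finset.sum_ite_mem]
  rw [treeDict, Finset.union_inter_cancel_left, Finset.union_inter_cancel_right,
    ← Finset.mul_sum, ← Finset.mul_sum, sum_consUnion, sum_consUnion]
  simp only [pathProb, ← Finset.mul_sum, sum_leaves hsum, Finset.sum_singleton, transProb,
    mul_one, hπ1]
  ring

theorem leaf_le_treeWeight (hP : ∀ a b, 0 < P a b) (hπ : ∀ a, 0 < π a) (hη0 : 0 < η) {t : List C}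
    (ht : t ∈ consUnion (leaves P θ n 1)) :
    (1 - η) * pathProb π P t ≤ treeWeight P π θ η n t := by
  rw [treeWeight, if_pos ht, le_add_iff_nonneg_right]
  split_ifs
  · exact (mul_pos hη0 (pathProb_pos hP hπ t)).le
  · exact le_rfl

theorem single_le_treeWeight (hP : ∀ a b, 0 < P a b) (hπ : ∀ a, 0 < π a) (hη1 : η < 1)
    {t : List C} (ht : t ∈ consUnion fun _ : C => {[]}) :
    η * pathProb π P t ≤ treeWeight P π θ η n t := by
  rw [treeWeight, if_pos ht, le_add_iff_nonneg_left]
  split_ifs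
  · exact (mul_pos (sub_pos.2 hη1) (pathProb_pos hP hπ t)).le
  · exact le_rfl

theorem treeWeight_pos (hP : ∀ a b, 0 < P a b) (hπ : ∀ a, 0 < π a) (hη0 : 0 < η) (hη1 : η < 1)
    {t : List C} (ht : t ∈ treeDict P θ n) : 0 < treeWeight P π θ η n t := by
  rcases Finset.mem_union.1 ht with ht | ht
  · exact (mul_pos (sub_pos.2 hη1) (pathProb_pos hP hπ t)).trans_le
      (leaf_le_treeWeight hP hπ hη0 ht)
  · exact (mul_pos hη0 (pathProb_pos hP hπ t)).trans_le (single_le_treeWeight hP hπ hη1 ht)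

end TreeWeight

theorem exists_tree_tokenizer [Fintype C] [DecidableEq C] [Nonempty C] {P : Matrix C C ℝ}
    {π : C → ℝ} {δ θ η : ℝ}
    (hsum : ∀ a, ∑ b, P a b = 1) (hδ : ∀ a b, δ ≤ P a b) (hδ0 : 0 < δ) (hδ1 : δ < 1)
    (hPδ : ∀ a b, P a b ≤ 1 - δ) (hπδ : ∀ a, δ ≤ π a) (hπ1 : ∑ a, π a = 1)
    (hcard : Fintype.card C * δ ≤ 1) (hθ : 0 < θ) (hθ1 : θ < 1) (hη0 : 0 < η) (hη1 : η < 1) :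
    ∃ T : Tokenizer C, T.dict.card * (δ ^ 2 * θ) ≤ 2 ∧ ∃ (Q : PMF T.dict) (c : T.dict → ℝ) (K : ℝ),
      0 ≤ K ∧ (∀ t, ENNReal.ofReal (Real.exp (-c t)) ≤ Q t) ∧
      ∀ l, ((T.enc l).map c).sum
        ≤ (1 + -Real.log ((1 - η) * δ) / -Real.log θ) * transInfo P l + K := by
  have hP : ∀ a b, 0 < P a b := fun a b => hδ0.trans_le (hδ a b)
  have hP1 : ∀ a b, P a b ≤ 1 := fun a b => (hPδ a b).trans (by linarith)
  have hπ0 : ∀ a, 0 < π a := fun a => hδ0.trans_le (hπδ a)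
  have hη' : 0 < 1 - η := sub_pos.2 hη1
  obtain ⟨n, hn⟩ := exists_pow_lt_of_lt_one hθ (by linarith : 1 - δ < 1)
  have hlogθ : 0 < -Real.log θ := neg_pos.2 (Real.log_neg hθ hθ1)
  have hlogη : 0 ≤ -Real.log ((1 - η) * δ) := neg_nonneg.2
    (Real.log_nonpos (by positivity) (mul_le_one₀ (by linarith) hδ0.le hδ1.le))
  have hK : 0 ≤ -Real.log (η * δ) := neg_nonneg.2
    (Real.log_nonpos (by positivity) (mul_le_one₀ hη1.le hδ0.le hδ1.le))
  have hmem : ∀ a : C, [a] ∈ consUnion fun _ : C => {[]} := fun a =>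
    cons_mem_consUnion.2 (by simp)
  obtain ⟨T, hT, hTc⟩ := exists_tokenizer (treeDict P θ n) (by
      intro t ht
      rcases Finset.mem_union.1 ht with ht | ht <;>
      · obtain ⟨b, l, -, rfl⟩ := mem_consUnion.1 ht
        exact List.cons_ne_nil _ _)
    (fun t => -Real.log (treeWeight P π θ η n t))
    (fun s => (1 + -Real.log ((1 - η) * δ) / -Real.log θ) * transInfo P s
      + n * -Real.log (η * δ))
    (exists_parse (θ := θ) hP hP1 (by positivity) hK
      (fun a => Finset.mem_union_right _ (hmem a))
      (fun a => by
        refine neg_le_neg (Real.log_le_log (by positivity) ?_)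
        refine le_trans ?_ (single_le_treeWeight hP hπ0 hη1 (hmem a))
        simpa [pathProb, transProb] using mul_le_mul_of_nonneg_left (hπδ a) hη0.le)
      (fun a l hl => Finset.mem_union_left _ (cons_mem_consUnion.2 hl))
      fun a l hl => by
        have ht := transProb_pos hP a l
        have h1 : transProb P a l ≤ θ := by
          simpa using mem_leaves_le hP hPδ (by linarith) zero_le_one (by simpa using hn.le) hl
        have h2 := Real.log_le_log ht h1
        have h3 : (1 - η) * δ * transProb P a l ≤ treeWeight P π θ η n (a :: l) := by
          refine le_trans ?_ (leaf_le_treeWeight hP hπ0 hη0 (cons_mem_consUnion.2 hl))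
          rw [pathProb, mul_assoc]
          gcongr
          exact hπδ a
        have h4 := Real.log_le_log (by positivity) h3
        rw [Real.log_mul (by positivity) ht.ne'] at h4
        -- The fixed cost per token becomes a multiple of the leaf's information, which is at least
        -- `-log θ`.
        have h5 : -Real.log ((1 - η) * δ)
            ≤ -Real.log ((1 - η) * δ) / -Real.log θ * -Real.log (transProb P a l) := by
          rw [div_mul_eq_mul_div, le_div_iff₀ hlogθ]
          exact mul_le_mul_of_nonneg_left (by linarith) hlogη
        rw [add_mul, one_mul]
        linarith)
  have hw : ∀ t : T.dict, 0 < treeWeight P π θ η n t := fun t =>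
    treeWeight_pos hP hπ0 hη0 hη1 (hT ▸ t.2)
  have : Nonempty T.dict := by
    obtain ⟨a⟩ := ‹Nonempty C›
    exact ⟨⟨[a], hT ▸ Finset.mem_union_right _ (hmem a)⟩⟩
  obtain ⟨Q, hQ⟩ := exists_pmf_ge (fun t : T.dict => treeWeight P π θ η n t) hw (by
    rw [Finset.sum_coe_sort T.dict (treeWeight P π θ η n), hT]
    exact (sum_treeWeight hsum hπ1).le)
  refine ⟨T, ?_, Q, _, _, by positivity, fun t => ?_, hTc⟩
  · rw [hT]
    exact card_treeDict_mul_le hsum hδ hδ0 hθ (mul_le_one₀ hδ1.le hθ.le hθ1.le) hcard n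
  · rw [neg_neg, Real.exp_log (hw t)]
    exact hQ t

/-- A one-letter codebook is treated apart: there `δ ≤ 1 / 2` may fail, but the image is
deterministic and a point mass has no loss. -/
theorem exists_tokenizer_of_subsingleton [Subsingleton C] (a : C) :
    ∃ T : Tokenizer C, T.dict.card = 1 ∧
      ∀ (s : Scenario) (m : ℕ) {Ω : Type*} [MeasurableSpace Ω] (μ : Measure Ω)
        (X : Ω → Image C m), ⨅ Q : Unigram T.dict, loss μ X (T.encImage s) Q = 0 := by
  have hsub : ∀ b : C, [b] ∈ ({[a]} : Finset (List C)) := fun b => by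
    simp [Subsingleton.elim b a]
  let T : Tokenizer C := ⟨{[a]}, by simp, fun s => s.map fun b => ⟨[b], hsub b⟩, fun s => by
    rw [List.map_map]
    exact (List.flatMap_def ..).symm.trans (List.flatMap_singleton' s)⟩
  refine ⟨T, rfl, fun s m Ω _ μ X => le_antisymm ?_ zero_le⟩
  let x : Image C m := fun _ _ => a
  let t₀ : T.dict := ⟨[a], hsub a⟩
  refine (iInf_le _ ⟨PMF.pure (T.encImage s x).length, PMF.pure t₀⟩).trans ?_
  have hprod : ∀ l : List T.dict, (l.map (PMF.pure t₀)).prod = 1 := fun l => by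
    refine List.prod_eq_one fun q hq => ?_
    obtain ⟨t, -, rfl⟩ := List.mem_map.1 hq
    have ht : t = t₀ := Subtype.ext (Finset.mem_singleton.1 t.2)
    simp [ht]
  have h : ∀ ω, Unigram.prob ⟨PMF.pure (T.encImage s x).length, PMF.pure t₀⟩
      (T.encImage s (X ω)) = 1 := fun ω => by
    rw [Subsingleton.elim (X ω) x, Unigram.prob, hprod]
    simp
  simp [loss, h, negLog]

/-! ### Choice of constants and conclusion -/

/-- The overhead per token is at most `ε` times the information in a leaf. -/
theorem overhead_le {δ : ℝ} (hδ0 : 0 < δ) (hδ : δ ≤ 1 / 2) {D : ℕ}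
    (hD : (2 / δ ^ 2) ^ 200 ≤ (D : ℝ)) :
    2 / (δ ^ 2 * D) < 1 ∧ Real.log (1 / δ) / (0.99 * Real.log D) < 1 ∧
      -Real.log ((1 - 1 / 1000) * δ) / -Real.log (2 / (δ ^ 2 * D))
        ≤ Real.log (1 / δ) / (0.99 * Real.log D) := by
  have hD0 : (0 : ℝ) < D := lt_of_lt_of_le (by positivity) hD
  have hlogD : 200 * Real.log (2 / δ ^ 2) ≤ Real.log D := by
    have := Real.log_le_log (by positivity) hD
    rwa [Real.log_pow, Nat.cast_ofNat] at this
  have hlogδ : Real.log 2 ≤ -Real.log δ := by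
    have := Real.log_le_log hδ0 hδ
    rw [one_div, Real.log_inv] at this
    linarith
  have hlog2 := Real.log_two_gt_d9
  have hsplit : Real.log (2 / δ ^ 2) = Real.log 2 - 2 * Real.log δ := by
    rw [Real.log_div two_ne_zero (by positivity), Real.log_pow, Nat.cast_ofNat]
  have hθ : -Real.log (2 / (δ ^ 2 * D)) = Real.log D - Real.log (2 / δ ^ 2) := by
    rw [← div_div, Real.log_div (by positivity) hD0.ne']
    ring
  have hη : -Real.log (1 - 1 / 1000) ≤ 0.002 := by
    have := Real.one_sub_inv_le_log_of_pos (by norm_num : (0 : ℝ) < 1 - 1 / 1000)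
    norm_num at this ⊢
    linarith
  have hinv : Real.log (1 / δ) = -Real.log δ := by rw [one_div, Real.log_inv]
  rw [hsplit] at hlogD hθ
  refine ⟨?_, ?_, ?_⟩
  · have h0 : 0 < 2 / (δ ^ 2 * D) := by positivity
    by_contra h
    have := Real.log_nonneg (not_lt.1 h)
    linarith
  · rw [hinv, div_lt_one (by linarith)]
    linarith
  · rw [hinv, Real.log_mul (by norm_num) hδ0.ne', hθ,
      div_le_div_iff₀ (by linarith) (by linarith)]
    -- Here `0.002 ≤ 0.005 * log 2`, and the exponent 200 makes `log (2 / δ ^ 2)` at most `0.005 *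
    -- log D`. The constant 0.99 works because `1.005 * 0.99 = 0.99495 ≤ 0.995`.
    have h1 : -(Real.log (1 - 1 / 1000) + Real.log δ) ≤ 1.005 * -Real.log δ := by linarith
    have h2 : 0.995 * Real.log D ≤ Real.log D - (Real.log 2 - 2 * Real.log δ) := by linarith
    calc -(Real.log (1 - 1 / 1000) + Real.log δ) * (0.99 * Real.log D)
        ≤ 1.005 * -Real.log δ * (0.99 * Real.log D) :=
          mul_le_mul_of_nonneg_right h1 (by linarith)
      _ = -Real.log δ * (0.99495 * Real.log D) := by ring
      _ ≤ _ := mul_le_mul_of_nonneg_left (by linarith) (by linarith)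

end ImageTok

theorem proposition2 (δ : ℝ) (hδ : 0 < δ) :
    ∃ D₀ : ℕ, ∀ {C : Type*} [Fintype C] [DecidableEq C]
      [MeasurableSpace C] [MeasurableSingletonClass C]
      (P : Matrix C C ℝ) (π : C → ℝ),
      P ∈ Matrix.rowStochastic ℝ C →
      π ∈ stdSimplex ℝ C →
      Matrix.vecMul π P = π →
      (∀ a a', δ ≤ P a a') →
      ∀ (s : ImageTok.Scenario) {Ω : ℕ → Type*} [∀ m, MeasurableSpace (Ω m)]
        (μ : ∀ m, Measure (Ω m)) [∀ m, IsProbabilityMeasure (μ m)]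
        (X : ∀ m, Ω m → ImageTok.Image C m),
        (∀ m, ImageTok.Generates s P π (μ m) (X m)) →
      ∀ D : ℕ, D₀ ≤ D →
        ∃ T : ImageTok.Tokenizer C, T.dict.card ≤ D ∧
          (∀ m, Function.Injective (T.encImage s : ImageTok.Image C m → List T.dict)) ∧
          limsup (fun m => ⨅ Q : ImageTok.Unigram T.dict,
              ImageTok.loss (μ m) (X m) (T.encImage s) Q) atTop
            ≤ ENNReal.ofReal
                (ImageTok.entropyRate P π / (1 - Real.log (1 / δ) / (0.99 * Real.log D))) := by
  refine ⟨⌈(2 / δ ^ 2) ^ 200⌉₊, ?_⟩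
  intro C _ _ _ _ P π hPs hπs hπ hPδ s Ω _ μ _ X hX D hD
  have hD' : (2 / δ ^ 2) ^ 200 ≤ (D : ℝ) := Nat.ceil_le.1 hD
  have hD0 : (0 : ℝ) < D := lt_of_lt_of_le (by positivity) hD'
  have hsum : ∀ a, ∑ b, P a b = 1 := fun a => Matrix.sum_row_of_mem_rowStochastic hPs a
  have hP : ∀ a b, 0 < P a b := fun a b => hδ.trans_le (hPδ a b)
  obtain ⟨hπ0, hπ1⟩ := hπs
  have hne : Nonempty C := by
    by_contra h
    rw [not_nonempty_iff] at h
    simp at hπ1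
  rcases subsingleton_or_nontrivial C with hC | hC
  · obtain ⟨a⟩ := hne
    obtain ⟨T, hcard, hloss⟩ := ImageTok.exists_tokenizer_of_subsingleton a
    refine ⟨T, hcard ▸ Nat.one_le_iff_ne_zero.2 (by exact_mod_cast hD0.ne'),
      fun m => T.encImage_injective s, ?_⟩
    have h := fun m => hloss s m (μ m) (X m)
    simp [h]
  have hP2 : ∀ a b, P a b ≤ 1 - δ := by
    intro a b
    obtain ⟨b', hb'⟩ := exists_ne b
    have h := Finset.add_le_sum (f := P a) (s := Finset.univ) (fun i _ => (hP a i).le)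
      (Finset.mem_univ b) (Finset.mem_univ b') hb'.symm
    rw [hsum] at h
    linarith [hPδ a b']
  have hδ2 : δ ≤ 1 / 2 := by
    obtain ⟨a⟩ := hne
    linarith [hPδ a a, hP2 a a]
  have hπδ : ∀ b, δ ≤ π b := by
    intro b
    rw [← hπ, ← mul_one δ, ← hπ1, Finset.mul_sum]
    refine Finset.sum_le_sum fun a _ => ?_
    rw [mul_comm]
    exact mul_le_mul_of_nonneg_left (hPδ a b) (hπ0 a)
  have hcard : Fintype.card C * δ ≤ 1 := by
    rw [← hπ1, ← nsmul_eq_mul]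
    exact Finset.card_nsmul_le_sum _ π δ fun a _ => hπδ a
  obtain ⟨hθ1, hε1, hκ⟩ := ImageTok.overhead_le hδ hδ2 hD'
  obtain ⟨T, hTcard, Q, c, K, hK, hQ, hc⟩ := ImageTok.exists_tree_tokenizer (P := P) (π := π)
    (θ := 2 / (δ ^ 2 * D)) (η := 1 / 1000) hsum hPδ hδ (by linarith) hP2 hπδ hπ1 hcard
    (by positivity) hθ1 (by norm_num) (by norm_num)
  have hP1 : ∀ a b, P a b ≤ 1 := fun a b => (hP2 a b).trans (by linarith)
  refine ⟨T, ?_, fun m => T.encImage_injective s, ?_⟩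
  -- The choice of `θ` turns the cardinality bound into exactly `D`.
  · have h : δ ^ 2 * (2 / (δ ^ 2 * D)) = 2 / D := by field_simp
    rw [h, mul_div_assoc', div_le_iff₀ hD0] at hTcard
    have : (T.dict.card : ℝ) ≤ D := by linarith
    exact_mod_cast this
  set κ := -Real.log ((1 - 1 / 1000) * δ) / -Real.log (2 / (δ ^ 2 * D))
  have hκ0 : 0 ≤ κ := div_nonneg
    (neg_nonneg.2 (Real.log_nonpos (by positivity) (by linarith)))
    (neg_nonneg.2 (Real.log_nonpos (by positivity) hθ1.le))
  have hH := ImageTok.entropyRate_nonneg hP hP1 hπ0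
  calc limsup (fun m => ⨅ Q : ImageTok.Unigram T.dict,
              ImageTok.loss (μ m) (X m) (T.encImage s) Q) atTop
      ≤ limsup (fun m : ℕ => ENNReal.ofReal ((1 + κ) * ImageTok.entropyRate P π
          + (Real.log ((m : ℝ) ^ 2 + 1) / m ^ 2 + K / m))) atTop := by
        refine limsup_le_limsup ?_
        filter_upwards [eventually_gt_atTop 0] with m hm
        exact ImageTok.iInf_loss_le (hX m) hm hP hsum hP1 hπ0 hπ T Q (by linarith) hK hQ hc
    _ = ENNReal.ofReal ((1 + κ) * ImageTok.entropyRate P π) :=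
        (ImageTok.tendsto_overhead _ K).limsup_eq
    _ ≤ _ := by
        refine ENNReal.ofReal_le_ofReal ?_
        set ε := Real.log (1 / δ) / (0.99 * Real.log D)
        rw [le_div_iff₀ (by linarith)]
        -- From `κ ≤ ε`: `(1 + ε) * (1 - ε) = 1 - ε ^ 2`.
        have h1 : (1 + κ) * (1 - ε) ≤ 1 := by
          nlinarith [mul_le_mul_of_nonneg_right hκ (by linarith : 0 ≤ 1 - ε), sq_nonneg ε]
        nlinarith [mul_le_mul_of_nonneg_right h1 hH]
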